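/- **Setting.** Let $(F,C)$ be a control-flow graph: a directed multigraph with finite node set $F$ (flow-points), $m=|F|$, and an initial flow-point $f_0$ from which all flow-points are reachable. Each $f\in F$ has its own set $\mathrm{Var}(f)$ of $n\ge 1$ variables ($n$ is the same for all $f$). A size-change graph $G:f\to g$ is a bipartite directed graph with source nodes $\mathrm{Var}(f)$ and target nodes $\mathrm{Var}(g)$ in which each arc is labeled strict ($\downarrow$) or non-strict ($\overline{\downarrow}$). An SCT instance $\mathcal G$ annotates every arc $c$ of the control-flow graph from $f$ to $g$ with a size-change graph $G_c:f\to g$. It satisfies SCT if for every infinite path $c_1c_2\dots$ in the control-flow graph, the layered graph $G_{c_1}G_{c_2}\cdots$ contains an infinite directed path (starting at any layer) with infinitely many strict arcs. It is fan-out free if every source node of every $G_c$ has out-degree at most 1. A set $P$ of variables of an SCT instance is a thread preserver if for each of its size-change graphs $G:f\to g$ and each $x\in \mathrm{Var}(f)\cap P$ there is an arc $x\to y$ of $G$ with $y\in P$. Let $B=m\cdot 2^n$. For $f\in F$ let $V_f$ be the set of tuples $\vec v=\langle v_1,v_2,\dots\rangle$ of even length whose odd positions are non-empty sets that form a partition of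 $\mathrm{Var}(f)$ and whose even positions are integers between $0$ and $B$. For $G:f\to g$ and $S\subseteq\mathrm{Var}(f)$ let $\Im(S,G)=\{y\mid x\to y\in G \text{ for some } x\in S\}$, and for $\vec v\in V_f$ and odd $i$ let $\Im_i=\Im_i(\vec v,G)=\Im(v_i,G)\setminus\bigcup_{\mathrm{odd}\ j<i}\Im(v_j,G)$. An odd position $i$ is descending if $|\Im_i|<|v_i|$, or $|\Im_i|=|v_i|$ and $G$ has a strict arc from $v_i$ to $\Im_i$. Define $\mathrm{next}(\vec v,G)\in V_g$ as follows. * (N1) If $i$ is the first descending position and $\Im_i\neq\emptyset$, then $\mathrm{next}(\vec v,G)=\langle \Im_1,v_2,\Im_3,\dots,\Im_i,B,S,B\rangle$, where $S$ is the set of variables of $g$ not occurring up to position $i$; if $S=\emptyset$, the final $S,B$ is omitted. * (N2) If $i$ is the first descending position and $\Im_i=\emptyset$, then $\mathrm{next}(\vec v,G)=\langle \Im_1,v_2,\dots,\Im_{i-2},v_{i-1}-1,S,B\rangle$, where $S$ is the set of variables of $g$ not occurring up to position $i-2$, provided that $i>1$ and $v_{i-1}>0$; otherwise it is undefined. * (N3)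 If no position is descending and $v_i$ is the last position, then $\mathrm{next}(\vec v,G)=\langle \Im_1,v_2,\dots,\Im_{i-1},v_i-1\rangle$ provided that $v_i>0$; otherwise it is undefined. Let $\mathcal R$ be the SCT instance with the same control-flow graph as $\mathcal G$, with $V_f$ as the set of variables of $f$, and where the size-change graph of an arc $c$ from $f$ to $g$ consists of the strict arcs $\vec v\to\mathrm{next}(\vec v,G_c)$, for all $\vec v\in V_f$ such that $\mathrm{next}(\vec v,G_c)$ is defined. **Theorem 4.14.** Suppose that $\mathcal G$ is fan-out free, satisfies SCT, and has a strongly connected control-flow graph. Let $S\subseteq\bigcup_f V_f$ be the closure of $\{\vec v_0\}$, where $\vec v_0=\langle\mathrm{Var}(f_0),B\rangle\in V_{f_0}$, under the partial operators $\mathrm{next}(\cdot,G)$ for all $G\in\mathcal G$. Then: 1. $S$ is a thread preserver of $\mathcal R$. 2. Hence $S$ can be used in place of the maximal thread preserver: $S\cap V_f\ne\emptyset$ for every $f$, and for every well-ordered set $D$ of values, $\rho(f,\sigma)=\min\{\sigma(\vec v)\mid \vec v\in S\cap V_f\}$ (for $f\in F$ and $\sigma:V_f\to D$) is a ranking function of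 $\mathcal R$. That is, $\rho(f,\sigma)>\rho(g,\sigma')$ whenever some arc $c$ from $f$ to $g$ satisfies $\sigma(\vec v)>\sigma'(\vec w)$ for all arcs $\vec v\to\vec w$ of the size-change graph of $c$ in $\mathcal R$. 3. (Companion theorem.) If $C$ is a sink strongly connected component of the directed graph on $S$ with the arcs $\vec v\to\mathrm{next}(\vec v,G)$, $G\in\mathcal G$, then $C$ is a thread preserver of $\mathcal R$. -/

import Mathlib

namespace SizeChange

/-- The two labels of a size-change arc: `strict` for `↓`, `nonstrict` for `↓=`. -/
inductive Label where
  | strict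
  | nonstrict
  deriving DecidableEq

/-- A size-change graph with source variables `X` and target variables `Y`: a bipartite directed
graph whose arcs carry a label. `G x y = some r` means that there is an arc `x → y`, labeled `r`;
`G x y = none` means that there is no arc from `x` to `y`. -/
abbrev SCG (X Y : Type*) := X → Y → Option Label

/-- An SCT instance (annotated control-flow graph): a directed multigraph on the flow-points `F`
with initial point `init`, from which all flow-points are reachable, where each flow-point `f` has
its own set `Var f` of variables and each arc from `f` to `g` is annotated with a size-change graph
with source `f` and target `g`. -/
structure ACG (F : Type*) (Var : F → Type*) where
  /-- the arcs of the control-flow graph -/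
  Arc : F → F → Type*
  /-- the initial flow-point -/
  init : F
  reachable : ∀ f, Relation.ReflTransGen (fun a b => Nonempty (Arc a b)) init f
  /-- the size-change graph annotating an arc -/
  graph : ∀ {f g : F}, Arc f g → SCG (Var f) (Var g)

namespace ACG

variable {F : Type*} {Var : F → Type*}

/-- The control-flow graph is strongly connected. -/
def StronglyConnected (𝒢 : ACG F Var) : Prop :=
  ∀ f g, Relation.ReflTransGen (fun a b => Nonempty (𝒢.Arc a b)) f g

/-- In every size-change graph every source node has out-degree at most one. -/
def FanOutFree (𝒢 : ACG F Var) : Prop :=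
  ∀ ⦃f g : F⦄ (c : 𝒢.Arc f g) (x : Var f) (y y' : Var g),
    𝒢.graph c x y ≠ none → 𝒢.graph c x y' ≠ none → y = y'

/-- An infinite multipath, given by an infinite path in the control-flow graph. -/
structure InfMultipath (𝒢 : ACG F Var) where
  point : ℕ → F
  arc : ∀ i, 𝒢.Arc (point i) (point (i + 1))

/-- An infinite thread of a multipath: an infinite directed path in the layered graph. It may start
at any layer. -/
structure InfThread (𝒢 : ACG F Var) (M : 𝒢.InfMultipath) where
  start : ℕ
  var : ∀ i, Var (M.point (start + i))
  isArc : ∀ i, 𝒢.graph (M.arc (start + i)) (var i) (var (i + 1)) ≠ none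

/-- A thread is infinitely descending if it includes infinitely many strict arcs. -/
def InfThread.InfinitelyDescending {𝒢 : ACG F Var} {M : 𝒢.InfMultipath}
    (τ : 𝒢.InfThread M) : Prop :=
  ∀ N, ∃ i, N ≤ i ∧
    𝒢.graph (M.arc (τ.start + i)) (τ.var i) (τ.var (i + 1)) = some Label.strict

/-- The SCT condition: every infinite multipath contains an infinitely descending thread. -/
def SatisfiesSCT (𝒢 : ACG F Var) : Prop :=
  ∀ M : 𝒢.InfMultipath, ∃ τ : 𝒢.InfThread M, τ.InfinitelyDescending

/-- A set `P` of variables (of all flow-points together) is a thread preserver if, for every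
size-change graph `G : f → g` of the instance, each variable of `f` in `P` has an arc of `G`
leading to some variable of `g` in `P`. -/
def ThreadPreserver (𝒢 : ACG F Var) (P : Set (Σ f, Var f)) : Prop :=
  ∀ ⦃f g : F⦄ (c : 𝒢.Arc f g) (x : Var f), (⟨f, x⟩ : Σ f, Var f) ∈ P →
    ∃ y : Var g, 𝒢.graph c x y ≠ none ∧ (⟨g, y⟩ : Σ f, Var f) ∈ P

end ACG

/-- `G ⊨ (f, σ) ↦ (g, σ')`: the stores `σ`, `σ'` satisfy all the constraints expressed by the arcs
of `G : f → g`. -/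
def Describes {X Y D : Type*} [LinearOrder D] (G : SCG X Y) (σ : X → D) (σ' : Y → D) : Prop :=
  ∀ x y, (G x y = some Label.strict → σ' y < σ x) ∧ (G x y = some Label.nonstrict → σ' y ≤ σ x)

/-- A ranking function for `𝒢` with values in a (well-founded) order `W`: it decreases strictly
along every state transition that is described by a size-change graph of `𝒢`. States are pairs of a
flow-point `f` and a store `Var f → D`. -/
def ACG.IsRankingFunction {F : Type*} {Var : F → Type*} (𝒢 : ACG F Var) {D W : Type*}
    [LinearOrder D] [Preorder W] (ρ : (Σ f, (Var f → D)) → W) : Prop :=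
  ∀ ⦃f g : F⦄ (c : 𝒢.Arc f g) (σ : Var f → D) (σ' : Var g → D),
    Describes (𝒢.graph c) σ σ' → ρ ⟨g, σ'⟩ < ρ ⟨f, σ⟩

section Vectors

/-- Tuples of even length, written as lists of blocks: the block `(s, k)` with (zero-based) index
`j` holds the set-valued odd position `2 j + 1` and the numeric even position `2 j + 2`. -/
abbrev Tuple (X : Type*) := List (Finset X × ℕ)

/-- The set of tuples `V_f^B` for `X = Var(f)`: the sets in the odd positions are non-empty and
form a partition of the set of all variables, the numbers are between `0` and `B`. -/
structure IsVec {X : Type*} (B : ℕ) (v : Tuple X) : Prop where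
  nonempty : ∀ p ∈ v, p.1.Nonempty
  disjoint : v.Pairwise fun p q => Disjoint p.1 q.1
  cover : ∀ x : X, ∃ p ∈ v, x ∈ p.1
  le_bound : ∀ p ∈ v, p.2 ≤ B

/-- `V_f^B`, for `X = Var(f)`. -/
abbrev Vec (X : Type*) (B : ℕ) := {v : Tuple X // IsVec B v}

/-- The vector `⟨Var(f), B⟩`. -/
def topVec (X : Type*) [Fintype X] [Nonempty X] (B : ℕ) : Vec X B :=
  ⟨[(Finset.univ, B)], by simp, by simp, by simp, by simp⟩

variable {X Y : Type*} [DecidableEq Y]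

/-- The set in the odd position of block `j`. -/
def setAt (v : Tuple X) (j : ℕ) : Finset X := (v.getD j (∅, 0)).1

/-- The number in the even position of block `j`. -/
def numAt (v : Tuple X) (j : ℕ) : ℕ := (v.getD j (∅, 0)).2

variable [Fintype Y]

/-- `ℑ(S, G)`: the targets of the arcs of `G` that leave `S`. -/
def image (S : Finset X) (G : SCG X Y) : Finset Y :=
  Finset.univ.filter fun y => ∃ x ∈ S, G x y ≠ none

/-- `ℑ_i(v, G)` for the odd position `i` of block `j`: the image of that set, without the images of
the sets in lower odd positions. -/
def imageAt (v : Tuple X) (G : SCG X Y) (j : ℕ) : Finset Y :=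
  image (setAt v j) G \ (Finset.range j).biUnion fun k => image (setAt v k) G

/-- The odd position of block `j` is descending. -/
def Descending (v : Tuple X) (G : SCG X Y) (j : ℕ) : Prop :=
  (imageAt v G j).card < (setAt v j).card ∨
    ((imageAt v G j).card = (setAt v j).card ∧
      ∃ x ∈ setAt v j, ∃ y ∈ imageAt v G j, G x y = some Label.strict)

instance (v : Tuple X) (G : SCG X Y) (j : ℕ) : Decidable (Descending v G j) := by
  unfold Descending; infer_instance

/-- The blocks with index less than `j`, with each set replaced by its `ℑ_i(v, G)` and all numbers
kept. -/
def prefixImage (v : Tuple X) (G : SCG X Y) (j : ℕ) : Tuple Y :=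
  (List.range j).map fun k => (imageAt v G k, numAt v k)

/-- The target variables that do not occur in the sets of `w`. -/
def rest (w : Tuple Y) : Finset Y := Finset.univ.filter fun y => ∀ p ∈ w, y ∉ p.1

/-- `next(v, G)`, as an optional value; `none` stands for undefined. The three cases are:
* the first descending position belongs to block `j` and its image is non-empty: the image is
  followed by `B` and by the remaining variables, if any, with `B`;
* the first descending position belongs to block `j` and its image is empty: the number of block
  `j - 1` is decremented and the block is followed by the remaining variables, with `B`
  (undefined if there is no such block or its number is `0`);
* no position is descending: the last number is decremented (undefined if it is `0`). -/
def next (B : ℕ) (v : Tuple X) (G : SCG X Y) : Option (Tuple Y) :=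
  match (List.range v.length).find? (fun j => decide (Descending v G j)) with
  | some j =>
    if (imageAt v G j).Nonempty then
      let w := prefixImage v G j ++ [(imageAt v G j, B)]
      if rest w = ∅ then some w else some (w ++ [(rest w, B)])
    else if 0 < j ∧ 0 < numAt v (j - 1) then
      let w := prefixImage v G (j - 1) ++ [(imageAt v G (j - 1), numAt v (j - 1) - 1)]
      some (w ++ [(rest w, B)])
    else none
  | none =>
    let l := v.length - 1
    if 0 < numAt v l then some (prefixImage v G l ++ [(imageAt v G l, numAt v l - 1)]) else none

end Vectors

section Construction

variable {F : Type*} {Var : F → Type*} [∀ f, Fintype (Var f)] [∀ f, DecidableEq (Var f)]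

/-- The SCT instance `ℛ`: the control-flow graph is that of `𝒢`, the variables of `f` are the
vectors `V_f^B`, and the size-change graph of an arc `c` has the strict arcs `v → next(v, G_c)`, for
all `v` such that `next(v, G_c)` exists. -/
def vectorInstance (𝒢 : ACG F Var) (B : ℕ) : ACG F (fun f => Vec (Var f) B) where
  Arc := 𝒢.Arc
  init := 𝒢.init
  reachable := 𝒢.reachable
  graph := fun c v w => if next B v.1 (𝒢.graph c) = some w.1 then some Label.strict else none

/-- `v → next(v, G)` for some size-change graph `G` of `𝒢` whose source is the flow-point of `v`. -/
inductive Step (𝒢 : ACG F Var) (B : ℕ) :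
    (Σ f, Vec (Var f) B) → (Σ f, Vec (Var f) B) → Prop
  | mk {f g : F} (c : 𝒢.Arc f g) (v : Vec (Var f) B) (w : Vec (Var g) B)
      (h : next B v.1 (𝒢.graph c) = some w.1) : Step 𝒢 B ⟨f, v⟩ ⟨g, w⟩

/-- The closure of `{⟨Var(f₀), B⟩}` under `next(·, G)` for all `G` in `𝒢`: the smallest set of
vectors that contains `⟨Var(f₀), B⟩` and, with `v`, every existing `next(v, G)`. -/
inductive Closure (𝒢 : ACG F Var) [Nonempty (Var 𝒢.init)] (B : ℕ) :
    (Σ f, Vec (Var f) B) → Prop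
  | base : Closure 𝒢 B ⟨𝒢.init, topVec (Var 𝒢.init) B⟩
  | step {p q : Σ f, Vec (Var f) B} : Closure 𝒢 B p → Step 𝒢 B p q → Closure 𝒢 B q

/-- `Closure` as a set. -/
def closureSet (𝒢 : ACG F Var) [Nonempty (Var 𝒢.init)] (B : ℕ) : Set (Σ f, Vec (Var f) B) :=
  {p | Closure 𝒢 B p}

end Construction

/-- `C` is a sink strongly connected component of the directed graph with node set `S` and arc
relation `A` (restricted to `S`): it is the class of some node under mutual reachability, and no
arc leaves it. -/
def IsSinkSCC {α : Type*} (S : Set α) (A : α → α → Prop) (C : Set α) : Prop :=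
  let R : α → α → Prop := Relation.ReflTransGen fun a b => a ∈ S ∧ b ∈ S ∧ A a b
  (∃ a ∈ S, C = {b | b ∈ S ∧ R a b ∧ R b a}) ∧
    ∀ a ∈ C, ∀ b ∈ S, A a b → b ∈ C

end SizeChange

/-!
In a fan-out free graph images are never larger than their sources. Hence the sets that precede the
first descending position are carried over bijectively and without strict arcs. A number below `B`
after a set counts how often everything outside the union of the sets up to that one has been lost
while this union was carried along in this way; each such loss makes one set of variables *flush*
another. Flushing is a transitive relation on the `m * 2 ^ n` sets of variables. It is irreflexive
by SCT: on the repetition of a path along which a set flushes itself, a thread that stays outside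
the carried sets dies within one round, and one that enters them has no strict arc from then on. So
the number of sets flushing the current one grows with every loss and no number can be exhausted.
The same argument for the empty set shows that the first set of a reachable vector never loses its
whole image: by strong connectivity, one could return to the initial flow-point and repeat the loss.
-/

namespace SizeChange

section Tuples

variable {X : Type*} {B : ℕ} {v : Tuple X} {i j : ℕ}

theorem setAt_of_lt (h : j < v.length) : setAt v j = v[j].1 := by
  simp only [setAt, List.getD_eq_getElem _ _ h]

theorem setAt_of_length_le (h : v.length ≤ j) : setAt v j = ∅ := by
  rw [setAt, List.getD_eq_default _ _ h]

theorem numAt_of_lt (h : j < v.length) : numAt v j = v[j].2 := by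
  simp only [numAt, List.getD_eq_getElem _ _ h]

theorem IsVec.setAt_nonempty (hv : IsVec B v) (h : j < v.length) : (setAt v j).Nonempty := by
  rw [setAt_of_lt h]
  exact hv.nonempty _ (List.getElem_mem h)

theorem IsVec.numAt_le (hv : IsVec B v) (h : j < v.length) : numAt v j ≤ B := by
  rw [numAt_of_lt h]
  exact hv.le_bound _ (List.getElem_mem h)

theorem IsVec.disjoint_setAt (hv : IsVec B v) (h : i < j) :
    Disjoint (setAt v i) (setAt v j) := by
  rcases lt_or_ge j v.length with hj | hj
  · rw [setAt_of_lt hj, setAt_of_lt (h.trans hj)]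
    exact List.pairwise_iff_getElem.1 hv.disjoint i j (h.trans hj) hj h
  · rw [setAt_of_length_le hj]
    exact Finset.disjoint_empty_right _

theorem IsVec.ne_nil [Nonempty X] (hv : IsVec B v) : v ≠ [] := by
  obtain ⟨p, hp, -⟩ := hv.cover (Classical.arbitrary X)
  exact List.ne_nil_of_mem hp

variable [DecidableEq X]

/-- The union of the sets in the blocks with index less than `j`. -/
def initialUnion (v : Tuple X) (j : ℕ) : Finset X := (Finset.range j).biUnion (setAt v)

@[simp]
theorem initialUnion_zero (v : Tuple X) : initialUnion v 0 = ∅ := rfl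

theorem initialUnion_succ (v : Tuple X) (j : ℕ) :
    initialUnion v (j + 1) = initialUnion v j ∪ setAt v j := by
  rw [initialUnion, Finset.range_add_one, Finset.biUnion_insert, Finset.union_comm, initialUnion]

theorem mem_initialUnion_length {x : X} :
    x ∈ initialUnion v v.length ↔ ∃ p ∈ v, x ∈ p.1 := by
  simp only [initialUnion, Finset.mem_biUnion, Finset.mem_range]
  constructor
  · rintro ⟨k, hk, hx⟩
    exact ⟨v[k], List.getElem_mem hk, setAt_of_lt hk ▸ hx⟩
  · rintro ⟨p, hp, hx⟩
    obtain ⟨k, hk, rfl⟩ := List.getElem_of_mem hp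
    exact ⟨k, hk, (setAt_of_lt hk).symm ▸ hx⟩

theorem IsVec.disjoint_initialUnion_setAt (hv : IsVec B v) (j : ℕ) :
    Disjoint (initialUnion v j) (setAt v j) :=
  (Finset.disjoint_biUnion_left _ _ _).2 fun _ hk => hv.disjoint_setAt (Finset.mem_range.1 hk)

theorem IsVec.initialUnion_eq_univ_iff [Fintype X] (hv : IsVec B v) :
    initialUnion v j = Finset.univ ↔ v.length ≤ j := by
  constructor
  · intro h
    by_contra! hj
    obtain ⟨x, hx⟩ := hv.setAt_nonempty hj
    exact Finset.disjoint_left.1 (hv.disjoint_initialUnion_setAt j) (h ▸ Finset.mem_univ x) hx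
  · intro h
    refine Finset.eq_univ_of_forall fun x => ?_
    refine Finset.biUnion_subset_biUnion_of_subset_left _ (Finset.range_subset_range.2 h) ?_
    exact mem_initialUnion_length.2 (hv.cover x)

variable [Fintype X]

theorem rest_eq_compl (w : Tuple X) : rest w = (initialUnion w w.length)ᶜ := by
  ext y
  simp only [rest, Finset.mem_filter_univ, Finset.mem_compl, mem_initialUnion_length, not_exists,
    not_and]

/-- The tuple `w`, followed by the block of all variables that do not occur in it, with the number
`B`, if there are such variables. -/
def complete (B : ℕ) (w : Tuple X) : Tuple X := w ++ if rest w = ∅ then [] else [(rest w, B)]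

theorem setAt_complete_of_lt (B : ℕ) {w : Tuple X} (h : j < w.length) :
    setAt (complete B w) j = setAt w j := by
  rw [setAt, complete, List.getD_append _ _ _ _ h, setAt]

theorem numAt_complete_of_lt (B : ℕ) {w : Tuple X} (h : j < w.length) :
    numAt (complete B w) j = numAt w j := by
  rw [numAt, complete, List.getD_append _ _ _ _ h, numAt]

theorem setAt_complete_length (B : ℕ) (w : Tuple X) :
    setAt (complete B w) w.length = rest w := by
  rw [setAt, complete, List.getD_append_right _ _ _ _ le_rfl, Nat.sub_self]
  split_ifs with h
  · exact h.symm
  · rfl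

theorem numAt_complete_of_length_le {w : Tuple X} (hj : w.length ≤ j)
    (hj' : j < (complete B w).length) : numAt (complete B w) j = B := by
  rw [complete, List.length_append] at hj'
  rw [numAt, complete, List.getD_append_right _ _ _ _ hj]
  split_ifs at hj' ⊢
  · exact absurd hj' hj.not_gt
  · obtain rfl : j = w.length := le_antisymm (Nat.lt_succ_iff.1 hj') hj
    rw [Nat.sub_self]
    rfl

theorem initialUnion_complete (B : ℕ) {w : Tuple X} (h : j ≤ w.length) :
    initialUnion (complete B w) j = initialUnion w j :=
  Finset.biUnion_congr rfl fun _ hk =>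
    setAt_complete_of_lt B ((Finset.mem_range.1 hk).trans_le h)

theorem isVec_complete {w : Tuple X} (hne : ∀ p ∈ w, p.1.Nonempty)
    (hdisj : w.Pairwise fun p q => Disjoint p.1 q.1) (hB : ∀ p ∈ w, p.2 ≤ B) :
    IsVec B (complete B w) := by
  have hrest : ∀ y, y ∉ rest w ↔ ∃ p ∈ w, y ∈ p.1 := fun y => by
    rw [rest_eq_compl, Finset.mem_compl, not_not, mem_initialUnion_length]
  unfold complete
  split_ifs with h
  · rw [List.append_nil]
    exact ⟨hne, hdisj, fun y => (hrest y).1 (h ▸ Finset.notMem_empty y), hB⟩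
  · refine ⟨?_, List.pairwise_append.2 ⟨hdisj, List.pairwise_singleton _ _, ?_⟩, ?_, ?_⟩
    · exact List.forall_mem_append.2
        ⟨hne, List.forall_mem_singleton.2 (Finset.nonempty_iff_ne_empty.2 h)⟩
    · refine fun p hp => List.forall_mem_singleton.2 (Finset.disjoint_left.2 fun y hy => ?_)
      exact (hrest y).2 ⟨p, hp, hy⟩
    · intro y
      by_cases hy : y ∈ rest w
      · exact ⟨_, List.mem_append_right _ (List.mem_singleton_self _), hy⟩
      · obtain ⟨p, hp, hyp⟩ := (hrest y).1 hy
        exact ⟨p, List.mem_append_left _ hp, hyp⟩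
    · exact List.forall_mem_append.2 ⟨hB, List.forall_mem_singleton.2 le_rfl⟩

end Tuples

section Images

variable {X Y : Type*} [Fintype Y] {G : SCG X Y}

/-- No source node of a single size-change graph has two outgoing arcs. -/
def SCG.FanOutFree (G : SCG X Y) : Prop :=
  ∀ ⦃x : X⦄ ⦃y y' : Y⦄, G x y ≠ none → G x y' ≠ none → y = y'

theorem mem_image {S : Finset X} {y : Y} : y ∈ image S G ↔ ∃ x ∈ S, G x y ≠ none :=
  Finset.mem_filter_univ y

@[simp]
theorem image_empty (G : SCG X Y) : image ∅ G = ∅ := by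
  simp [image]

theorem SCG.FanOutFree.card_image_le (hG : G.FanOutFree) (S : Finset X) :
    (image S G).card ≤ S.card :=
  Finset.card_le_card_of_forall_subsingleton (fun y x => G x y ≠ none)
    (fun _ hy => mem_image.1 hy) fun _ _ _ hy _ hy' => hG hy.2 hy'.2

variable [DecidableEq Y]

theorem image_union [DecidableEq X] (S T : Finset X) (G : SCG X Y) :
    image (S ∪ T) G = image S G ∪ image T G := by
  ext y
  simp only [mem_image, Finset.mem_union, or_and_right, exists_or]

variable {B : ℕ} {v : Tuple X} {j b : ℕ}

theorem imageAt_of_length_le (G : SCG X Y) (h : v.length ≤ j) : imageAt v G j = ∅ := by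
  rw [imageAt, setAt_of_length_le h, image_empty, Finset.empty_sdiff]

theorem disjoint_imageAt (v : Tuple X) (G : SCG X Y) {i j : ℕ} (h : i < j) :
    Disjoint (imageAt v G i) (imageAt v G j) :=
  Finset.disjoint_of_subset_left
    (Finset.sdiff_subset.trans
      (Finset.subset_biUnion_of_mem (fun k => image (setAt v k) G) (Finset.mem_range.2 h)))
    Finset.disjoint_sdiff

theorem card_imageAt_of_not_descending (hG : G.FanOutFree) (h : ¬ Descending v G j) :
    (imageAt v G j).card = (setAt v j).card :=
  ((Finset.card_le_card Finset.sdiff_subset).trans (hG.card_image_le _)).antisymm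
    (not_lt.1 fun hlt => h (Or.inl hlt))

theorem IsVec.imageAt_nonempty (hv : IsVec B v) (hG : G.FanOutFree) (hj : j < v.length)
    (h : ¬ Descending v G j) : (imageAt v G j).Nonempty := by
  rw [← Finset.card_pos, card_imageAt_of_not_descending hG h]
  exact (hv.setAt_nonempty hj).card_pos

theorem not_strict_of_not_descending (hG : G.FanOutFree) (h : ¬ Descending v G j) {x : X}
    (hx : x ∈ setAt v j) (y : Y) : G x y ≠ some Label.strict := by
  intro hxy
  have hcard := card_imageAt_of_not_descending hG h
  have himage : imageAt v G j = image (setAt v j) G :=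
    Finset.eq_of_subset_of_card_le Finset.sdiff_subset (hcard ▸ hG.card_image_le _)
  refine h (Or.inr ⟨hcard, x, hx, y, ?_, hxy⟩)
  rw [himage]
  exact mem_image.2 ⟨x, hx, by simp [hxy]⟩

variable [DecidableEq X]

theorem not_strict_of_mem_initialUnion (hG : G.FanOutFree) (hd : ∀ k < j, ¬ Descending v G k)
    {x : X} (hx : x ∈ initialUnion v j) (y : Y) : G x y ≠ some Label.strict := by
  obtain ⟨k, hk, hxk⟩ := Finset.mem_biUnion.1 hx
  exact not_strict_of_not_descending hG (hd k (Finset.mem_range.1 hk)) hxk y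

theorem biUnion_image_setAt (v : Tuple X) (G : SCG X Y) (j : ℕ) :
    ((Finset.range j).biUnion fun k => image (setAt v k) G) = image (initialUnion v j) G := by
  ext y
  simp only [initialUnion, mem_image, Finset.mem_biUnion]
  tauto

theorem imageAt_eq_sdiff (v : Tuple X) (G : SCG X Y) (j : ℕ) :
    imageAt v G j = image (setAt v j) G \ image (initialUnion v j) G := by
  rw [imageAt, biUnion_image_setAt]

theorem image_initialUnion_succ (v : Tuple X) (G : SCG X Y) (j : ℕ) :
    image (initialUnion v (j + 1)) G = image (initialUnion v j) G ∪ imageAt v G j := by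
  rw [initialUnion_succ, image_union, imageAt_eq_sdiff, Finset.union_sdiff_self_eq_union]

theorem IsVec.card_image_initialUnion (hv : IsVec B v) (hG : G.FanOutFree)
    (hd : ∀ k < j, ¬ Descending v G k) :
    (image (initialUnion v j) G).card = (initialUnion v j).card := by
  induction j with
  | zero => simp
  | succ j ih =>
    have hdisj : Disjoint (image (initialUnion v j) G) (imageAt v G j) := by
      rw [imageAt_eq_sdiff]
      exact Finset.disjoint_sdiff
    rw [image_initialUnion_succ, Finset.card_union_of_disjoint hdisj, initialUnion_succ,
      Finset.card_union_of_disjoint (hv.disjoint_initialUnion_setAt j),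
      card_imageAt_of_not_descending hG (hd j j.lt_succ_self),
      ih fun k hk => hd k (hk.trans j.lt_succ_self)]

end Images

section Next

variable {X Y : Type*} [Fintype Y] [DecidableEq Y] {G : SCG X Y} {B : ℕ} {v : Tuple X}
  {j k b : ℕ}

/-- The blocks with index at most `j`, with each set replaced by its `ℑ_i(v, G)`, and with the
number of block `j` replaced by `b`: the part that the three cases of `next` have in common. -/
def truncation (v : Tuple X) (G : SCG X Y) (j b : ℕ) : Tuple Y :=
  prefixImage v G j ++ [(imageAt v G j, b)]

@[simp]
theorem length_truncation (v : Tuple X) (G : SCG X Y) (j b : ℕ) :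
    (truncation v G j b).length = j + 1 := by
  simp [truncation, prefixImage]

theorem setAt_truncation (v : Tuple X) (G : SCG X Y) (b : ℕ) (h : k ≤ j) :
    setAt (truncation v G j b) k = imageAt v G k := by
  rw [setAt_of_lt (by simpa using Nat.lt_succ_of_le h)]
  rcases h.lt_or_eq with h | rfl <;> simp [truncation, prefixImage, *]

theorem numAt_truncation_of_lt (v : Tuple X) (G : SCG X Y) (b : ℕ) (h : k < j) :
    numAt (truncation v G j b) k = numAt v k := by
  rw [numAt_of_lt (by simpa using h.trans j.lt_succ_self)]
  simp [truncation, prefixImage, h]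

theorem numAt_truncation_self (v : Tuple X) (G : SCG X Y) (j b : ℕ) :
    numAt (truncation v G j b) j = b := by
  rw [numAt_of_lt (by simp)]
  simp [truncation, prefixImage]

theorem isVec_complete_truncation (hG : G.FanOutFree) (hv : IsVec B v) (hj : j < v.length)
    (hb : b ≤ B) (hd : ∀ k < j, ¬ Descending v G k) (hne : (imageAt v G j).Nonempty) :
    IsVec B (complete B (truncation v G j b)) := by
  have hmem : ∀ p ∈ truncation v G j b,
      (∃ k < j, p = (imageAt v G k, numAt v k)) ∨ p = (imageAt v G j, b) := fun p hp => by
    simpa [truncation, prefixImage, eq_comm] using hp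
  refine isVec_complete (fun p hp => ?_) ?_ (fun p hp => ?_)
  · rcases hmem p hp with ⟨k, hk, rfl⟩ | rfl
    · exact hv.imageAt_nonempty hG (hk.trans hj) (hd k hk)
    · exact hne
  · refine List.pairwise_iff_getElem.2 fun i k hi hk hik => ?_
    rw [length_truncation] at hk
    rw [← setAt_of_lt, ← setAt_of_lt, setAt_truncation _ _ _ (by lia),
      setAt_truncation _ _ _ (by lia)]
    exact disjoint_imageAt v G hik
  · rcases hmem p hp with ⟨k, hk, rfl⟩ | rfl
    · exact hv.numAt_le (hk.trans hj)
    · exact hb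

theorem initialUnion_truncation [DecidableEq X] (v : Tuple X) (G : SCG X Y) (b : ℕ)
    (h : k ≤ j + 1) :
    initialUnion (truncation v G j b) k = image (initialUnion v k) G := by
  induction k with
  | zero => simp
  | succ k ih =>
    rw [initialUnion_succ, ih (by lia), setAt_truncation v G b (by lia), image_initialUnion_succ]

theorem rest_truncation [DecidableEq X] (v : Tuple X) (G : SCG X Y) (j b : ℕ) :
    rest (truncation v G j b) = (image (initialUnion v (j + 1)) G)ᶜ := by
  rw [rest_eq_compl, length_truncation, initialUnion_truncation v G b le_rfl]

theorem IsVec.rest_truncation_eq_empty_iff [Fintype X] (hv : IsVec B v) (hG : G.FanOutFree)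
    (hcard : Fintype.card X = Fintype.card Y) (hd : ∀ k < j + 1, ¬ Descending v G k) :
    rest (truncation v G j b) = ∅ ↔ v.length ≤ j + 1 := by
  classical
  rw [rest_truncation, Finset.compl_eq_empty_iff, ← Finset.card_eq_iff_eq_univ,
    hv.card_image_initialUnion hG hd, ← hcard, Finset.card_eq_iff_eq_univ,
    hv.initialUnion_eq_univ_iff]

/-- The definition of `next`, rearranged according to what happens to the sets. The second
alternative is (N1). The third one combines (N2) and (N3): the sets up to block `j` are carried over
without descent, and nothing else is left of the next block, or there is none. -/
theorem next_cases [Fintype X] [Nonempty X] (hG : G.FanOutFree)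
    (hcard : Fintype.card X = Fintype.card Y) (hv : IsVec B v) :
    imageAt v G 0 = ∅ ∨
    (∃ j < v.length, (∀ k < j, ¬ Descending v G k) ∧ (imageAt v G j).Nonempty ∧
      next B v G = some (complete B (truncation v G j B))) ∨
    (∃ j < v.length, (∀ k < j + 1, ¬ Descending v G k) ∧ imageAt v G (j + 1) = ∅ ∧
      (0 < numAt v j →
        next B v G = some (complete B (truncation v G j (numAt v j - 1))))) := by
  cases hfind : (List.range v.length).find? fun j => decide (Descending v G j) with
  | some j =>
    obtain ⟨-, hj, hd⟩ := List.find?_range_eq_some.1 hfind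
    replace hj : j < v.length := List.mem_range.1 hj
    replace hd : ∀ k < j, ¬ Descending v G k := by simpa using hd
    by_cases hne : (imageAt v G j).Nonempty
    · refine Or.inr (Or.inl ⟨j, hj, hd, hne, ?_⟩)
      simp only [next, hfind, hne, if_true, complete, truncation]
      split_ifs with h <;> simp [h]
    · have hempty : imageAt v G j = ∅ := Finset.not_nonempty_iff_eq_empty.1 hne
      cases j with
      | zero => exact Or.inl hempty
      | succ i =>
        have hrest : rest (truncation v G i (numAt v i - 1)) ≠ ∅ := fun h =>
          hj.not_ge ((hv.rest_truncation_eq_empty_iff hG hcard hd).1 h)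
        refine Or.inr (Or.inr ⟨i, i.lt_succ_self.trans hj, hd, hempty, fun hnum => ?_⟩)
        rw [complete, if_neg hrest]
        simp [next, hfind, hne, hnum, truncation]
  | none =>
    have hd : ∀ k < v.length, ¬ Descending v G k := by
      simpa using List.find?_range_eq_none.1 hfind
    obtain ⟨l, hl⟩ := Nat.exists_eq_add_one.2 (List.length_pos_of_ne_nil hv.ne_nil)
    rw [hl] at hd
    have hrest : rest (truncation v G l (numAt v l - 1)) = ∅ :=
      (hv.rest_truncation_eq_empty_iff hG hcard hd).2 hl.le
    refine Or.inr (Or.inr ⟨l, by lia, hd, imageAt_of_length_le G hl.le, fun hnum => ?_⟩)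
    rw [complete, if_pos hrest]
    simp only [next, hfind]
    simp [hl, hnum, truncation]

end Next

section Flushing

open Relation

theorem exists_recurrent_seq_of_transGen_self {α : Type*} {r : α → α → Prop} {a : α}
    (h : TransGen r a a) :
    ∃ s : ℕ → α, (∀ i, r (s i) (s (i + 1))) ∧ ∃ᶠ i in Filter.atTop, s i = a := by
  obtain ⟨b, hab, hba⟩ := TransGen.head'_iff.1 h
  obtain ⟨l, hchain, hlast⟩ := List.exists_isChain_cons_of_relationReflTransGen hba
  have hlt : ∀ i, i % (l.length + 1) < (b :: l).length := fun i => Nat.mod_lt _ l.length.succ_pos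
  have hend : (b :: l)[l.length] = a := by
    rw [← hlast, List.getLast_eq_getElem]
    rfl
  refine ⟨fun i => (b :: l)[i % (l.length + 1)]'(hlt i), fun i => ?_, ?_⟩
  · rcases (Nat.lt_succ_iff.1 (hlt i)).lt_or_eq with hi | hi
    · have hsucc : (i + 1) % (l.length + 1) = i % (l.length + 1) + 1 := by
        rw [← Nat.mod_add_mod, Nat.mod_eq_of_lt (Nat.succ_lt_succ hi)]
      simp only [hsucc]
      exact List.isChain_iff_getElem.1 hchain _ (Nat.succ_lt_succ hi)
    · have hsucc : (i + 1) % (l.length + 1) = 0 := by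
        rw [← Nat.mod_add_mod, hi, Nat.mod_self]
      simp only [hsucc, hi, hend]
      exact hab
  · refine (Nat.frequently_mod_eq l.length.lt_succ_self).mono fun i hi => ?_
    simp only [hi, hend]

variable {F : Type*} {Var : F → Type*} {𝒢 : ACG F Var}

theorem ACG.InfThread.InfinitelyDescending.notMem {M : 𝒢.InfMultipath} {τ : 𝒢.InfThread M}
    (hτ : τ.InfinitelyDescending) {U : ∀ i, Finset (Var (M.point i))}
    (hU : ∀ i, ∀ x ∈ U i, ∀ y, 𝒢.graph (M.arc i) x y ≠ none → y ∈ U (i + 1))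
    (hstrict : ∀ i, ∀ x ∈ U i, ∀ y, 𝒢.graph (M.arc i) x y ≠ some Label.strict) (i : ℕ) :
    τ.var i ∉ U (τ.start + i) := by
  intro hi
  have hstay : ∀ k ≥ i, τ.var k ∈ U (τ.start + k) := fun k hk =>
    Nat.le_induction hi (fun k _ ih => hU _ _ ih _ (τ.isArc k)) k hk
  obtain ⟨k, hk, hdesc⟩ := hτ i
  exact hstrict _ _ (hstay k hk) _ hdesc

/-- A flow-point with two sets `(U, T)` of its variables, for following a path of the control-flow
graph: `U` is the set to be carried along without strict arcs, and `T` is what is left, outside `U`,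
of the other variables. -/
abbrev Config (Var : F → Type*) := Σ f, Finset (Var f) × Finset (Var f)

variable [∀ f, Fintype (Var f)] [∀ f, DecidableEq (Var f)]

/-- The transition of configurations along an arc: `U` is carried to its image, which requires that
no strict arc leaves `U`, and `T` is carried to the part of its image outside the new `U`. -/
def FlushStep (𝒢 : ACG F Var) (p q : Config Var) : Prop :=
  ∃ c : 𝒢.Arc p.1 q.1, (∀ x ∈ p.2.1, ∀ y, 𝒢.graph c x y ≠ some Label.strict) ∧
    q.2.1 = image p.2.1 (𝒢.graph c) ∧ q.2.2 = image p.2.2 (𝒢.graph c) \ q.2.1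

/-- The set `a` flushes `b`: some non-empty path carries `a` to `b` without strict arcs, and all
variables outside `a` are lost on the way. -/
def Flushes (𝒢 : ACG F Var) (a b : Σ f, Finset (Var f)) : Prop :=
  TransGen (FlushStep 𝒢) ⟨a.1, a.2, a.2ᶜ⟩ ⟨b.1, b.2, ∅⟩

theorem Flushes.trans {a b c : Σ f, Finset (Var f)} (hab : Flushes 𝒢 a b)
    (hbc : Flushes 𝒢 b c) : Flushes 𝒢 a c := by
  refine TransGen.trans hab (TransGen.lift
    (fun p : Config Var => (⟨p.1, p.2.1, ∅⟩ : Config Var)) ?_ _ _ hbc)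
  rintro p q ⟨e, hstrict, hU, -⟩
  exact ⟨e, hstrict, hU, by simp⟩

/-- The configuration `p`, with `T` reset to all variables outside `U` if `p` is `e`. -/
noncomputable def refill (e p : Config Var) : Config Var :=
  open scoped Classical in ⟨p.1, p.2.1, if p = e then p.2.1ᶜ else p.2.2⟩

theorem mem_refill {e p : Config Var} {x : Var p.1} (hx : x ∉ p.2.1)
    (h : p = e ∨ x ∈ p.2.2) : x ∈ (refill e p).2.2 := by
  unfold refill
  dsimp only
  split_ifs with hp
  · exact Finset.mem_compl.2 hx
  · exact h.resolve_left hp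

theorem exists_recurrent_seq_refill {a : Σ f, Finset (Var f)} (h : Flushes 𝒢 a a) :
    ∃ s : ℕ → Config Var, (∀ i, FlushStep 𝒢 (refill ⟨a.1, a.2, ∅⟩ (s i)) (s (i + 1))) ∧
      ∃ᶠ i in Filter.atTop, s i = ⟨a.1, a.2, ∅⟩ := by
  obtain ⟨q, haq, hqa⟩ := TransGen.head'_iff.1 h
  refine exists_recurrent_seq_of_transGen_self
    (r := fun p q => FlushStep 𝒢 (refill ⟨a.1, a.2, ∅⟩ p) q) (TransGen.head' (b := q) ?_ ?_)
  · simpa only [refill, if_true] using haq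
  · clear haq
    induction hqa using ReflTransGen.head_induction_on with
    | refl => exact .refl
    | @head p q hpq _ ih =>
      by_cases hp : p = ⟨a.1, a.2, ∅⟩
      · exact hp ▸ .refl
      · exact ih.head (by simpa only [refill, if_neg hp] using hpq)

/-- An infinitely descending thread of the repeated cycle would have to avoid the carried set, but
everything outside that set is lost within one round. -/
theorem not_flushes_self (hsct : 𝒢.SatisfiesSCT) (a : Σ f, Finset (Var f)) :
    ¬ Flushes 𝒢 a a := by
  intro h
  obtain ⟨s, hs, hrec⟩ := exists_recurrent_seq_refill h
  choose c hstrict hU hT using hs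
  obtain ⟨τ, hτ⟩ := hsct ⟨fun i => (s i).1, c⟩
  have hout : ∀ i, τ.var i ∉ (s (τ.start + i)).2.1 := hτ.notMem (U := fun i => (s i).2.1)
    (fun i x hx y hxy => (hU i).symm ▸ mem_image.2 ⟨x, hx, hxy⟩) hstrict
  have hstep : ∀ i, τ.var i ∈ (refill ⟨a.1, a.2, ∅⟩ (s (τ.start + i))).2.2 →
      τ.var (i + 1) ∈ (s (τ.start + i + 1)).2.2 := fun i hi => by
    rw [hT]
    exact Finset.mem_sdiff.2 ⟨mem_image.2 ⟨_, hi, τ.isArc i⟩, hout (i + 1)⟩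
  obtain ⟨_, hle, hvisit⟩ := Filter.frequently_atTop.1 hrec τ.start
  obtain ⟨i, rfl⟩ := Nat.exists_eq_add_of_le hle
  have hstay : ∀ k ≥ i, τ.var k ∈ (refill ⟨a.1, a.2, ∅⟩ (s (τ.start + k))).2.2 := by
    intro k hk
    induction k, hk using Nat.le_induction with
    | base => exact mem_refill (hout i) (Or.inl hvisit)
    | succ k _ ih => exact mem_refill (hout (k + 1)) (Or.inr (hstep k ih))
  obtain ⟨_, hle', hvisit'⟩ := Filter.frequently_atTop.1 hrec (τ.start + i + 1)
  obtain ⟨k, rfl⟩ := Nat.exists_eq_add_of_le hle'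
  have hmem := hstep (i + k) (hstay (i + k) (Nat.le_add_right i k))
  have hlost : ∀ p : Config Var, p = ⟨a.1, a.2, ∅⟩ → p.2.2 = ∅ := by
    rintro _ rfl
    rfl
  rw [hlost] at hmem
  · exact Finset.notMem_empty _ hmem
  · rw [← hvisit']
    congr 1
    lia

/-- The number of sets that flush `a`. -/
noncomputable def flushHeight (𝒢 : ACG F Var) (a : Σ f, Finset (Var f)) : ℕ :=
  {b | Flushes 𝒢 b a}.ncard

theorem Flushes.flushHeight_lt [Finite F] (hsct : 𝒢.SatisfiesSCT) {a b : Σ f, Finset (Var f)}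
    (h : Flushes 𝒢 a b) : flushHeight 𝒢 a < flushHeight 𝒢 b :=
  Set.ncard_lt_ncard ⟨fun _ hc => Flushes.trans hc h, fun hs => not_flushes_self hsct a (hs h)⟩

theorem flushHeight_lt_card [Fintype F] (hsct : 𝒢.SatisfiesSCT) {n : ℕ}
    (hn : ∀ f, Fintype.card (Var f) = n) (a : Σ f, Finset (Var f)) :
    flushHeight 𝒢 a < Fintype.card F * 2 ^ n := by
  have hcard : Nat.card (Σ f, Finset (Var f)) = Fintype.card F * 2 ^ n := by
    simp [Nat.card_eq_fintype_card, hn]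
  exact hcard ▸ Set.ncard_lt_card fun h => not_flushes_self hsct a (h.ge (Set.mem_univ a))

end Flushing

section Records

open Relation

variable {F : Type*} {Var : F → Type*} {𝒢 : ACG F Var} {B : ℕ} {f g : F} {v : Tuple (Var f)}
  {a : Σ f, Finset (Var f)} {j k b : ℕ}

theorem ACG.FanOutFree.graph (hfan : 𝒢.FanOutFree) (c : 𝒢.Arc f g) :
    SCG.FanOutFree (𝒢.graph c) :=
  fun x y y' => hfan c x y y'

variable [∀ f, Fintype (Var f)] [∀ f, DecidableEq (Var f)]

theorem flushStep_of_not_descending (hfan : 𝒢.FanOutFree) (c : 𝒢.Arc f g)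
    (hd : ∀ k < j, ¬ Descending v (𝒢.graph c) k) :
    FlushStep 𝒢 ⟨f, initialUnion v j, setAt v j⟩
      ⟨g, image (initialUnion v j) (𝒢.graph c), imageAt v (𝒢.graph c) j⟩ :=
  ⟨c, fun _ hx => not_strict_of_mem_initialUnion (hfan.graph c) hd hx, rfl,
    imageAt_eq_sdiff v (𝒢.graph c) j⟩

/-- Some path carries `a` to the union of the first `j` sets of `v` without strict arcs, and what is
left of the other variables is the next set of `v`. -/
def Traced (𝒢 : ACG F Var) (a : Σ f, Finset (Var f)) (v : Tuple (Var f)) (j : ℕ) : Prop :=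
  ReflTransGen (FlushStep 𝒢) ⟨a.1, a.2, a.2ᶜ⟩ ⟨f, initialUnion v j, setAt v j⟩

theorem Traced.flushes (h : Traced 𝒢 a v j) (hfan : 𝒢.FanOutFree) (c : 𝒢.Arc f g)
    (hd : ∀ k < j, ¬ Descending v (𝒢.graph c) k) (hempty : imageAt v (𝒢.graph c) j = ∅) :
    Flushes 𝒢 a ⟨g, image (initialUnion v j) (𝒢.graph c)⟩ :=
  TransGen.tail' h (hempty ▸ flushStep_of_not_descending hfan c hd)

theorem Traced.complete_truncation (h : Traced 𝒢 a v k) (hfan : 𝒢.FanOutFree) (c : 𝒢.Arc f g)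
    (hkj : k ≤ j) (hd : ∀ i < k, ¬ Descending v (𝒢.graph c) i) :
    Traced 𝒢 a (complete B (truncation v (𝒢.graph c) j b)) k := by
  have hlt : k < (truncation v (𝒢.graph c) j b).length := by
    rw [length_truncation]
    exact Nat.lt_succ_of_le hkj
  unfold Traced
  rw [initialUnion_complete B hlt.le, initialUnion_truncation v _ b (Nat.le_succ_of_le hkj),
    setAt_complete_of_lt B hlt, setAt_truncation v _ b hkj]
  exact h.tail (flushStep_of_not_descending hfan c hd)

theorem traced_complete_truncation (𝒢 : ACG F Var) (v : Tuple (Var f)) (G : SCG (Var f) (Var g))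
    (B j b : ℕ) :
    Traced 𝒢 ⟨g, image (initialUnion v (j + 1)) G⟩ (complete B (truncation v G j b)) (j + 1) := by
  have hrest := setAt_complete_length B (truncation v G j b)
  rw [length_truncation, rest_truncation] at hrest
  unfold Traced
  rw [initialUnion_complete B (length_truncation v G j b).ge, hrest,
    initialUnion_truncation v G b le_rfl]

/-- The history recorded in a reachable vector: the first set consists of all that is left of the
variables of the initial flow-point, and a number below `B` in block `j` has been decremented at
most once more than there are sets flushing `a`, where `a` is traced to the sets up to block `j`. -/
structure Recorded (𝒢 : ACG F Var) (B : ℕ) (v : Tuple (Var f)) : Prop where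
  first : Traced 𝒢 ⟨𝒢.init, ∅⟩ v 0
  count : ∀ j < v.length,
    numAt v j = B ∨ ∃ a, B ≤ numAt v j + flushHeight 𝒢 a + 1 ∧ Traced 𝒢 a v (j + 1)

theorem recorded_topVec (𝒢 : ACG F Var) [Nonempty (Var 𝒢.init)] (B : ℕ) :
    Recorded 𝒢 B (topVec (Var 𝒢.init) B).1 := by
  refine ⟨?_, fun j hj => Or.inl ?_⟩
  · unfold Traced
    rw [Finset.compl_empty]
    exact .refl
  · obtain rfl : j = 0 := Nat.lt_one_iff.1 hj
    rfl

theorem Flushes.empty_of_reachable (hf : Flushes 𝒢 a ⟨f, ∅⟩)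
    (h : ReflTransGen (fun a b => Nonempty (𝒢.Arc a b)) f g) : Flushes 𝒢 a ⟨g, ∅⟩ := by
  induction h with
  | refl => exact hf
  | tail _ hc ih =>
    obtain ⟨c⟩ := hc
    exact TransGen.tail ih ⟨c, by simp, by simp, by simp⟩

/-- If the first set were lost, one could return to the initial flow-point and start again. -/
theorem Recorded.imageAt_zero_ne_empty (hv : Recorded 𝒢 B v) (hconn : 𝒢.StronglyConnected)
    (hfan : 𝒢.FanOutFree) (hsct : 𝒢.SatisfiesSCT) (c : 𝒢.Arc f g) :
    imageAt v (𝒢.graph c) 0 ≠ ∅ := by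
  intro hempty
  have hlost : Flushes 𝒢 ⟨𝒢.init, ∅⟩ ⟨g, image (initialUnion v 0) (𝒢.graph c)⟩ :=
    hv.first.flushes hfan c (fun _ hk => absurd hk (Nat.not_lt_zero _)) hempty
  rw [initialUnion_zero, image_empty] at hlost
  exact not_flushes_self hsct ⟨𝒢.init, ∅⟩ (hlost.empty_of_reachable (hconn g 𝒢.init))

/-- When the number of block `j` is to be decremented, everything outside the first `j + 1` sets has
just been lost once more, so the set reached is flushed by one more set than before. -/
theorem Recorded.le_numAt_add_flushHeight [Finite F] (hv : Recorded 𝒢 B v)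
    (hfan : 𝒢.FanOutFree) (hsct : 𝒢.SatisfiesSCT) (c : 𝒢.Arc f g) (hj : j < v.length)
    (hd : ∀ k < j + 1, ¬ Descending v (𝒢.graph c) k)
    (hempty : imageAt v (𝒢.graph c) (j + 1) = ∅) :
    B ≤ numAt v j + flushHeight 𝒢 ⟨g, image (initialUnion v (j + 1)) (𝒢.graph c)⟩ := by
  rcases hv.count j hj with hB | ⟨a, ha, htraced⟩
  · exact hB ▸ Nat.le_add_right _ _
  · have hlt := (htraced.flushes hfan c hd hempty).flushHeight_lt hsct
    lia

theorem Recorded.complete_truncation (hv : Recorded 𝒢 B v) (hfan : 𝒢.FanOutFree)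
    (c : 𝒢.Arc f g) (hj : j < v.length) (hd : ∀ k < j, ¬ Descending v (𝒢.graph c) k)
    (hb : b = B ∨
      B ≤ b + flushHeight 𝒢 ⟨g, image (initialUnion v (j + 1)) (𝒢.graph c)⟩ + 1) :
    Recorded 𝒢 B (complete B (truncation v (𝒢.graph c) j b)) := by
  have hlen : (truncation v (𝒢.graph c) j b).length = j + 1 := length_truncation _ _ _ _
  refine ⟨hv.first.complete_truncation hfan c j.zero_le
    fun _ hk => absurd hk (Nat.not_lt_zero _), fun k hk => ?_⟩
  rcases lt_trichotomy k j with hkj | rfl | hjk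
  · rw [numAt_complete_of_lt B (by lia), numAt_truncation_of_lt v _ b hkj]
    refine (hv.count k (hkj.trans hj)).imp_right fun ⟨a, ha, htraced⟩ => ⟨a, ha, ?_⟩
    exact htraced.complete_truncation hfan c hkj fun i hi => hd i (by lia)
  · rw [numAt_complete_of_lt B (by lia), numAt_truncation_self]
    exact hb.imp_right fun hb => ⟨_, hb, traced_complete_truncation 𝒢 v (𝒢.graph c) B k b⟩
  · exact Or.inl (numAt_complete_of_length_le (by lia) hk)

variable [Fintype F] {n : ℕ}

theorem Recorded.exists_next [Nonempty (Var f)] (hrec : Recorded 𝒢 B v) (hv : IsVec B v)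
    (hn : ∀ f, Fintype.card (Var f) = n) (hconn : 𝒢.StronglyConnected) (hfan : 𝒢.FanOutFree)
    (hsct : 𝒢.SatisfiesSCT) (hB : Fintype.card F * 2 ^ n ≤ B) (c : 𝒢.Arc f g) :
    ∃ w, next B v (𝒢.graph c) = some w ∧ IsVec B w ∧ Recorded 𝒢 B w := by
  have hG := hfan.graph c
  rcases next_cases hG ((hn f).trans (hn g).symm) hv with
    hempty | ⟨j, hj, hd, hne, hnext⟩ | ⟨j, hj, hd, hempty, hnext⟩
  · exact absurd hempty (hrec.imageAt_zero_ne_empty hconn hfan hsct c)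
  · exact ⟨_, hnext, isVec_complete_truncation hG hv hj le_rfl hd hne,
      hrec.complete_truncation hfan c hj hd (Or.inl rfl)⟩
  · have hd' : ∀ k < j, ¬ Descending v (𝒢.graph c) k := fun k hk => hd k (hk.trans j.lt_succ_self)
    have hle := hrec.le_numAt_add_flushHeight hfan hsct c hj hd hempty
    have hlt := flushHeight_lt_card hsct hn ⟨g, image (initialUnion v (j + 1)) (𝒢.graph c)⟩
    exact ⟨_, hnext (by lia),
      isVec_complete_truncation hG hv hj ((Nat.sub_le _ _).trans (hv.numAt_le hj)) hd'
        (hv.imageAt_nonempty hG hj (hd j j.lt_succ_self)),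
      hrec.complete_truncation hfan c hj hd' (Or.inr (by lia))⟩

variable [∀ f, Nonempty (Var f)]

theorem Closure.recorded (hn : ∀ f, Fintype.card (Var f) = n) (hconn : 𝒢.StronglyConnected)
    (hfan : 𝒢.FanOutFree) (hsct : 𝒢.SatisfiesSCT) (hB : Fintype.card F * 2 ^ n ≤ B)
    {p : Σ f, Vec (Var f) B} (hp : Closure 𝒢 B p) : Recorded 𝒢 B p.2.1 := by
  induction hp with
  | base => exact recorded_topVec 𝒢 B
  | step _ hstep ih =>
    obtain ⟨c, v, w, hw⟩ := hstep
    obtain ⟨w', hw', -, hrec⟩ := ih.exists_next v.2 hn hconn hfan hsct hB c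
    exact Option.some_injective _ (hw'.symm.trans hw) ▸ hrec

theorem threadPreserver_of_subset_closureSet (hn : ∀ f, Fintype.card (Var f) = n)
    (hconn : 𝒢.StronglyConnected) (hfan : 𝒢.FanOutFree) (hsct : 𝒢.SatisfiesSCT)
    (hB : Fintype.card F * 2 ^ n ≤ B) {P : Set (Σ f, Vec (Var f) B)}
    (hP : P ⊆ closureSet 𝒢 B) (hclosed : ∀ p ∈ P, ∀ q, Step 𝒢 B p q → q ∈ P) :
    (vectorInstance 𝒢 B).ThreadPreserver P := by
  intro f g c v hv
  have hrec : Recorded 𝒢 B v.1 := Closure.recorded hn hconn hfan hsct hB (hP hv)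
  obtain ⟨w, hnext, hw, -⟩ := hrec.exists_next v.2 hn hconn hfan hsct hB c
  refine ⟨⟨w, hw⟩, ?_, hclosed _ hv _ (Step.mk (𝒢 := 𝒢) c v ⟨w, hw⟩ hnext)⟩
  simp [vectorInstance, hnext]

end Records

section ThreadPreservers

theorem ACG.ThreadPreserver.exists_mem {F : Type*} {V : F → Type*} {ℛ : ACG F V}
    {P : Set (Σ f, V f)} (hP : ℛ.ThreadPreserver P) {v : V ℛ.init} (hv : ⟨ℛ.init, v⟩ ∈ P) (f : F) :
    ∃ w, ⟨f, w⟩ ∈ P := by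
  induction ℛ.reachable f with
  | refl => exact ⟨v, hv⟩
  | tail _ hc ih =>
    obtain ⟨c⟩ := hc
    obtain ⟨x, hx⟩ := ih
    obtain ⟨y, -, hy⟩ := hP c x hx
    exact ⟨y, hy⟩

theorem ACG.ThreadPreserver.exists_isRankingFunction {F : Type*} {V : F → Type*} {ℛ : ACG F V}
    {P : Set (Σ f, V f)} (hP : ℛ.ThreadPreserver P) (hne : ∀ f, ∃ v, ⟨f, v⟩ ∈ P)
    (hstrict : ∀ ⦃f g : F⦄ (c : ℛ.Arc f g) x y, ℛ.graph c x y ≠ some Label.nonstrict)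
    (D : Type*) [LinearOrder D] [WellFoundedLT D] :
    ∃ ρ : (Σ f, (V f → D)) → D,
      (∀ s, IsLeast (s.2 '' {v | ⟨s.1, v⟩ ∈ P}) (ρ s)) ∧ ℛ.IsRankingFunction ρ := by
  have hmin : ∀ s : Σ f, (V f → D), ∃ d, IsLeast (s.2 '' {v | ⟨s.1, v⟩ ∈ P}) d := fun s =>
    have himage : (s.2 '' {v | ⟨s.1, v⟩ ∈ P}).Nonempty := Set.Nonempty.image s.2 (hne s.1)
    ⟨_, wellFounded_lt.min_mem _ himage, fun _ hx => WellFounded.min_le wellFounded_lt hx⟩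
  choose ρ hρ using hmin
  refine ⟨ρ, hρ, fun f g c σ σ' hdesc => ?_⟩
  obtain ⟨v, hv, hvρ⟩ := (hρ ⟨f, σ⟩).1
  obtain ⟨w, hvw, hw⟩ := hP c v hv
  have hlabel : ℛ.graph c v w = some Label.strict := by
    rcases hlab : ℛ.graph c v w with _ | _ | _
    · exact absurd hlab hvw
    · rfl
    · exact absurd hlab (hstrict c v w)
  calc ρ ⟨g, σ'⟩ ≤ σ' w := (hρ ⟨g, σ'⟩).2 ⟨w, hw, rfl⟩
    _ < σ v := (hdesc v w).1 hlabel
    _ = ρ ⟨f, σ⟩ := hvρ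

theorem vectorInstance_graph_ne_nonstrict {F : Type*} {Var : F → Type*} [∀ f, Fintype (Var f)]
    [∀ f, DecidableEq (Var f)] (𝒢 : ACG F Var) (B : ℕ) {f g : F}
    (c : (vectorInstance 𝒢 B).Arc f g) (v : Vec (Var f) B) (w : Vec (Var g) B) :
    (vectorInstance 𝒢 B).graph c v w ≠ some Label.nonstrict := by
  simp only [vectorInstance]
  split_ifs <;> simp

end ThreadPreservers

end SizeChange

open SizeChange in
theorem theorem4p14_general {F : Type*} [Fintype F] {Var : F → Type*}
    [∀ f, Fintype (Var f)] [∀ f, DecidableEq (Var f)] [∀ f, Nonempty (Var f)]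
    {n : ℕ} (hn : ∀ f, Fintype.card (Var f) = n) {𝒢 : ACG F Var}
    (hconn : 𝒢.StronglyConnected) (hfan : 𝒢.FanOutFree) (hsct : 𝒢.SatisfiesSCT)
    {B : ℕ} (hB : Fintype.card F * 2 ^ n ≤ B) :
    (vectorInstance 𝒢 B).ThreadPreserver (closureSet 𝒢 B) ∧
    (∀ f, ∃ v, (⟨f, v⟩ : Σ f, Vec (Var f) B) ∈ closureSet 𝒢 B) ∧
    (∀ (D : Type*) [LinearOrder D] [WellFoundedLT D],
      ∃ ρ : (Σ f, (Vec (Var f) B → D)) → D,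
        (∀ s, IsLeast (s.2 '' {v | ⟨s.1, v⟩ ∈ closureSet 𝒢 B}) (ρ s)) ∧
        (vectorInstance 𝒢 B).IsRankingFunction ρ) ∧
    (∀ C, IsSinkSCC (closureSet 𝒢 B) (Step 𝒢 B) C → (vectorInstance 𝒢 B).ThreadPreserver C) := by
  have hclosure : (vectorInstance 𝒢 B).ThreadPreserver (closureSet 𝒢 B) :=
    threadPreserver_of_subset_closureSet hn hconn hfan hsct hB subset_rfl fun _ hp _ =>
      Closure.step hp
  have hmem : ∀ f, ∃ v, (⟨f, v⟩ : Σ f, Vec (Var f) B) ∈ closureSet 𝒢 B :=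
    hclosure.exists_mem Closure.base
  refine ⟨hclosure, hmem, fun D _ _ => hclosure.exists_isRankingFunction hmem
    (fun _ _ => vectorInstance_graph_ne_nonstrict 𝒢 B) D, ?_⟩
  rintro C ⟨⟨a, -, rfl⟩, hsink⟩
  exact threadPreserver_of_subset_closureSet hn hconn hfan hsct hB (fun _ hp => hp.1)
    fun p hp q hpq => hsink p hp q (Closure.step hp.1 hpq) hpq

theorem theorem4p14 {F : Type*} [Fintype F] {Var : F → Type*}
    [∀ f, Fintype (Var f)] [∀ f, DecidableEq (Var f)] [∀ f, Nonempty (Var f)]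
    (n : ℕ) (hn : ∀ f, Fintype.card (Var f) = n)
    (𝒢 : SizeChange.ACG F Var)
    (hconn : 𝒢.StronglyConnected) (hfan : 𝒢.FanOutFree) (hsct : 𝒢.SatisfiesSCT)
    (B : ℕ) (hB : B = Fintype.card F * 2 ^ n) :
    -- the closure is a thread preserver of the vector instance
    (SizeChange.vectorInstance 𝒢 B).ThreadPreserver (SizeChange.closureSet 𝒢 B) ∧
    -- it can be used for a ranking function: it has a vector at every flow-point, and taking
    -- the minimum over it gives a ranking function of the vector instance
    (∀ f, ∃ v, (⟨f, v⟩ : Σ f, SizeChange.Vec (Var f) B) ∈ SizeChange.closureSet 𝒢 B) ∧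
    (∀ (D : Type*) [LinearOrder D] [WellFoundedLT D],
      ∃ ρ : (Σ f, (SizeChange.Vec (Var f) B → D)) → D,
        (∀ s, IsLeast (s.2 '' {v | ⟨s.1, v⟩ ∈ SizeChange.closureSet 𝒢 B}) (ρ s)) ∧
        (SizeChange.vectorInstance 𝒢 B).IsRankingFunction ρ) ∧
    -- any sink strongly connected component of the reachability graph is a thread preserver
    (∀ C, SizeChange.IsSinkSCC (SizeChange.closureSet 𝒢 B) (SizeChange.Step 𝒢 B) C →
      (SizeChange.vectorInstance 𝒢 B).ThreadPreserver C) :=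
  theorem4p14_general hn hconn hfan hsct hB.ge
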